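/- Let $\mathbb F\in\{\mathbb R,\mathbb C\}$. A family of scalars $(c_i)$ (indexed by $\mathbb N$, by $\mathbb N^2$, or by one point) is *computable* if there is a recursive $f$ such that $|q_{f(i,m)}-c_i|\le 2^{-m}$ for all $i,m$, where $(q_n)$ is a standard recursive enumeration of $\mathbb Q$ (if $\mathbb F=\mathbb R$) or $\mathbb Q+i\mathbb Q$ (if $\mathbb F=\mathbb C$). Let $\mathbb F_{\rm k}$ be the set of computable scalars. Let $X$ be a Banach space over $\mathbb F$ with a computability structure, i.e. a non-empty set of sequences in $X$, called computable, such that: 1. (linear combinations) if $(x_n),(y_n)$ are computable sequences in $X$, $(\alpha_{nk}),(\beta_{nk})$ are computable double sequences in $\mathbb F$ and $d:\mathbb N\to\mathbb N$ is recursive, then $\bigl(\sum_{k=0}^{d(n)}(\alpha_{nk}x_k+\beta_{nk}y_k)\bigr)_n$ is computable; 2. (limits) if $(x_{nk})$ is a computable double sequence in $X$ (i.e. computable as a sequence via a standard recursive pairing $\mathbb N^2\cong\mathbb N$) and there is a recursive $g$ with $\|x_{nk}-x_n\|\le 2^{-N}$ for all $n,N$ and all $k\ge g(n,N)$, then $(x_n)$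 is computable; 3. (norms) if $(x_n)$ is computable, then $(\|x_n\|)$ is a computable sequence of real numbers. Let $X_{\rm k}$ be the set of computable elements, i.e. of those $x\in X$ for which the constant sequence $(x,x,\dots)$ is computable; it is closed under linear combinations with coefficients in $\mathbb F_{\rm k}$. Assume that $X$ is an effective Banach space: there is an effectively generating set, i.e. a computable sequence $(e_n)$ whose linear span is dense in $X$ (in particular $X$ is separable). Fix such an $(e_n)$, and let $(a_n)$ be a standard recursive enumeration of its rational span (coefficients in $\mathbb Q$, resp. $\mathbb Q+i\mathbb Q$). With $\varphi_i$ the $i$-th partial recursive function, call $i\in\mathbb N$ a standard index of $x\in X$, and write $\alpha(i)=x$, if $\varphi_i$ is total and $\|a_{\varphi_i(n)}-x\|<2^{-n}$ for all $n$. Let $T:X_{\rm k}\to X_{\rm k}$ be linear, i.e. $T(ax+by)=aTx+bTy$ for $x,y\in X_{\rm k}$ and $a,b\in\mathbb F_{\rm k}$, and effective, i.e. there is a partial recursive function $\varphi$, defined on all standard indices, such that $\varphi(i)$ is a standard index of $Tx$ whenever $i$ is a standard index of $x\in X_{\rm k}$. Then there is a unique continuous $\mathbb F$-linear operator $\tilde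 T:X\to X$ with $\tilde Tx=Tx$ for all $x\in X_{\rm k}$. -/

import Mathlib

/-- A recursive total numbering of the rational numbers. -/
def ratOfNat (n : ℕ) : ℚ :=
  ((n.unpair.1.unpair.1 : ℚ) - (n.unpair.1.unpair.2 : ℚ)) / ((n.unpair.2 : ℚ) + 1)

/-- A recursive total numbering of the rational scalars: `ℚ` when `𝕜 = ℝ` (there `RCLike.I = 0`)
and `ℚ + iℚ` when `𝕜 = ℂ`. -/
noncomputable def scalarOfNat (𝕜 : Type*) [RCLike 𝕜] (n : ℕ) : 𝕜 :=
  (ratOfNat n.unpair.1 : 𝕜) + (ratOfNat n.unpair.2 : 𝕜) * RCLike.I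

/-- A family of scalars is computable if, uniformly in the index, it is the effective limit of
a recursive sequence of rational scalars. With `ι = ℕ`, `ι = ℕ × ℕ`, `ι = Unit` these are the
computable sequences, double sequences and single scalars. -/
def IsComputableFamily {𝕜 : Type*} [RCLike 𝕜] {ι : Type*} [Primcodable ι] (c : ι → 𝕜) : Prop :=
  ∃ f : ι × ℕ → ℕ, Computable f ∧
    ∀ (i : ι) (m : ℕ), ‖scalarOfNat 𝕜 (f (i, m)) - c i‖ ≤ (2 : ℝ)⁻¹ ^ m

/-- A computable scalar. -/
def IsComputableScalar {𝕜 : Type*} [RCLike 𝕜] (c : 𝕜) : Prop :=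
  IsComputableFamily (fun _ : Unit => c)

/-- A computability structure (in the sense of Pour-El and Richards) on a normed space: the
set of computable sequences, subject to the axioms on linear combinations, limits and norms.
Double sequences in `X` are identified with sequences through the standard pairing of `ℕ × ℕ`
with `ℕ`. -/
structure ComputabilityStructure (𝕜 X : Type*) [RCLike 𝕜] [NormedAddCommGroup X]
    [NormedSpace 𝕜 X] where
  /-- The computable sequences. -/
  seqs : Set (ℕ → X)
  nonempty : seqs.Nonempty
  linear : ∀ x ∈ seqs, ∀ y ∈ seqs, ∀ a b : ℕ × ℕ → 𝕜,
    IsComputableFamily a → IsComputableFamily b → ∀ d : ℕ → ℕ, Computable d →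
      (fun n => ∑ k ∈ Finset.range (d n + 1), (a (n, k) • x k + b (n, k) • y k)) ∈ seqs
  limit : ∀ (x : ℕ → ℕ → X) (l : ℕ → X),
    (fun m : ℕ => x m.unpair.1 m.unpair.2) ∈ seqs →
    (∃ g : ℕ × ℕ → ℕ, Computable g ∧
      ∀ n N k : ℕ, g (n, N) ≤ k → ‖x n k - l n‖ ≤ (2 : ℝ)⁻¹ ^ N) →
    l ∈ seqs
  norm : ∀ x ∈ seqs, IsComputableFamily (fun n : ℕ => ‖x n‖)

namespace ComputabilityStructure

variable {𝕜 X : Type*} [RCLike 𝕜] [NormedAddCommGroup X] [NormedSpace 𝕜 X]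

/-- The computable elements: those whose constant sequence is computable. -/
def elements (S : ComputabilityStructure 𝕜 X) : Set X :=
  {x | (fun _ : ℕ => x) ∈ S.seqs}

/-- The computable elements are closed under linear combinations with computable scalars. -/
theorem lincomb_mem (S : ComputabilityStructure 𝕜 X) {a b : 𝕜} (ha : IsComputableScalar a)
    (hb : IsComputableScalar b) {x y : X} (hx : x ∈ S.elements) (hy : y ∈ S.elements) :
    a • x + b • y ∈ S.elements := by
  have key : ∀ {c : 𝕜}, IsComputableScalar c → IsComputableFamily (fun _ : ℕ × ℕ => c) := by
    rintro c ⟨f, hf, hfc⟩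
    refine ⟨fun p => f ((), p.2), hf.comp ?_, fun i m => hfc () m⟩
    exact (Computable.const ()).pair Computable.snd
  have h := S.linear _ hx _ hy _ _ (key ha) (key hb) (fun _ => 0) (Computable.const 0)
  simpa [elements] using h

/-- An effectively generating set: a computable sequence whose linear span is dense. -/
def IsEGS (S : ComputabilityStructure 𝕜 X) (e : ℕ → X) : Prop :=
  e ∈ S.seqs ∧ Dense (Submodule.span 𝕜 (Set.range e) : Set X)

/-- A map on the computable elements is linear if it respects linear combinations with
computable scalars. -/
def IsLinearOperator (S : ComputabilityStructure 𝕜 X) (T : S.elements → S.elements) : Prop :=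
  ∀ (a b : 𝕜) (ha : IsComputableScalar a) (hb : IsComputableScalar b) (x y : S.elements),
    (T ⟨a • (x : X) + b • (y : X), S.lincomb_mem ha hb x.2 y.2⟩ : X) =
      a • (T x : X) + b • (T y : X)

end ComputabilityStructure

/-- The enumeration `a₀, a₁, …` of the rational span of `e`: the number `n` codes a finite list
of (numbers of) rational coefficients. -/
noncomputable def ratSpanSeq (𝕜 : Type*) {X : Type*} [RCLike 𝕜] [NormedAddCommGroup X]
    [NormedSpace 𝕜 X] (e : ℕ → X) (n : ℕ) : X :=
  let l : List ℕ := (Encodable.decode (α := List ℕ) n).getD []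
  ∑ k ∈ Finset.range l.length, scalarOfNat 𝕜 (l.getD k 0) • e k

/-- The graph of the standard (partial) numbering `α` given by `e`: the `i`-th partial recursive
function `φ_i` is total and `‖a_{φ_i(n)} - x‖ < 2⁻ⁿ` for all `n`. -/
def IsStandardIndex (𝕜 : Type*) {X : Type*} [RCLike 𝕜] [NormedAddCommGroup X]
    [NormedSpace 𝕜 X] (e : ℕ → X) (i : ℕ) (x : X) : Prop :=
  ∀ n : ℕ, ∃ m ∈ (Denumerable.ofNat Nat.Partrec.Code i).eval n,
    ‖ratSpanSeq 𝕜 e m - x‖ < (2 : ℝ)⁻¹ ^ n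

namespace ComputabilityStructure

variable {𝕜 X : Type*} [RCLike 𝕜] [NormedAddCommGroup X] [NormedSpace 𝕜 X]

/-- `T` is effective with respect to the standard numbering given by `e`: some partial recursive
function sends every standard index of `x` to a standard index of `T x`. -/
def IsEffective (S : ComputabilityStructure 𝕜 X) (e : ℕ → X) (T : S.elements → S.elements) :
    Prop :=
  ∃ φ : ℕ →. ℕ, Partrec φ ∧ ∀ (i : ℕ) (x : S.elements), IsStandardIndex 𝕜 e i (x : X) →
    ∃ j ∈ φ i, IsStandardIndex 𝕜 e j (T x : X)

end ComputabilityStructure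

/-! Continuity comes first, from effectiveness alone, by a Kreisel–Lacombe–Shoenfield argument
(`exists_norm_sub_le_of_isEffective`). If `T` jumps at `b 0` along a computable sequence `b`, then
for every candidate value `v` there are points `b m` arbitrarily near `b 0` with `T (b m)` far from
`v`. Strict inequalities between computable reals are semidecidable, so a search finds such an `m`.
By the recursion theorem, a program can output approximations of `b 0` until it sees an
approximation `v` of `T` at its own output, and then switch to a `b m` refuting `v`. The switch is
late enough to agree with the outputs already made, so the program is an index of `b m`, and `v`
must approximate `T (b m)`: a contradiction.

Prepending a computable `x` to the rational span gives continuity at `x` along the `a_n`. Continuity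
at `0` bounds `T` on small `a_n`, and continuity at each small `x` transfers the bound to `x`.
Linearity turns this into `‖T x‖ ≤ C * ‖x‖`, after which density and completeness give the extension
and its uniqueness. -/

/-! ### Semidecidable predicates -/

/-- Unbounded search that always succeeds computes the least solution. -/
theorem Computable₂.exists_least {α : Type*} [Primcodable α] {g : α → ℕ → Bool}
    (hg : Computable₂ g) (ht : ∀ a, ∃ n, g a n = true) :
    ∃ f : α → ℕ, Computable f ∧ (∀ a, g a (f a) = true) ∧ ∀ a, ∀ m < f a, g a m = false := by
  classical
  refine ⟨fun a => Nat.find (ht a), (Partrec.rfind hg.partrec₂).of_eq_tot fun a => ?_,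
    fun a => Nat.find_spec (ht a), fun a m hm => ?_⟩
  · refine Nat.mem_rfind.2 ⟨Part.mem_some_iff.2 (Nat.find_spec (ht a)).symm, fun hm => ?_⟩
    exact Part.mem_some_iff.2 (by simpa using Nat.find_min (ht a) hm)
  · simpa using Nat.find_min (ht a) hm

/-- A predicate is semidecidable if it is the projection of a computable Boolean relation. -/
def IsSemidecidable {α : Type*} [Primcodable α] (p : α → Prop) : Prop :=
  ∃ g : α → ℕ → Bool, Computable₂ g ∧ ∀ a, p a ↔ ∃ n, g a n = true

namespace IsSemidecidable

variable {α β : Type*} [Primcodable α] [Primcodable β]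

theorem comp {p : β → Prop} (hp : IsSemidecidable p) {f : α → β} (hf : Computable f) :
    IsSemidecidable fun a => p (f a) := by
  obtain ⟨g, hg, h⟩ := hp
  exact ⟨fun a n => g (f a) n, hg.comp (hf.comp Computable.fst) Computable.snd, fun a => h (f a)⟩

theorem and {p q : α → Prop} (hp : IsSemidecidable p) (hq : IsSemidecidable q) :
    IsSemidecidable fun a => p a ∧ q a := by
  obtain ⟨g, hg, h⟩ := hp
  obtain ⟨g', hg', h'⟩ := hq
  refine ⟨fun a n => g a n.unpair.1 && g' a n.unpair.2, ?_, fun a => ?_⟩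
  · refine Primrec.and.to_comp.comp (hg.comp Computable.fst ?_) (hg'.comp Computable.fst ?_)
    · exact Computable.fst.comp (Computable.unpair.comp Computable.snd)
    · exact Computable.snd.comp (Computable.unpair.comp Computable.snd)
  · change p a ∧ q a ↔ _
    rw [h, h']
    constructor
    · rintro ⟨⟨m, hm⟩, n, hn⟩
      exact ⟨Nat.pair m n, by simp [hm, hn]⟩
    · rintro ⟨n, hn⟩
      rw [Bool.and_eq_true] at hn
      exact ⟨⟨_, hn.1⟩, _, hn.2⟩

theorem exists_nat {p : α × ℕ → Prop} (hp : IsSemidecidable p) :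
    IsSemidecidable fun a => ∃ n, p (a, n) := by
  obtain ⟨g, hg, h⟩ := hp
  refine ⟨fun a n => g (a, n.unpair.1) n.unpair.2, ?_, fun a => ?_⟩
  · refine hg.comp (Computable.fst.pair ?_) ?_
    · exact Computable.fst.comp (Computable.unpair.comp Computable.snd)
    · exact Computable.snd.comp (Computable.unpair.comp Computable.snd)
  · constructor
    · rintro ⟨n, hn⟩
      obtain ⟨m, hm⟩ := (h _).1 hn
      exact ⟨Nat.pair n m, by simpa using hm⟩
    · rintro ⟨n, hn⟩
      exact ⟨_, (h _).2 ⟨_, hn⟩⟩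

/-- A total semidecidable relation has a computable choice function. -/
theorem exists_computable_choice {p : α × ℕ → Prop} (hp : IsSemidecidable p)
    (ht : ∀ a, ∃ n, p (a, n)) : ∃ f : α → ℕ, Computable f ∧ ∀ a, p (a, f a) := by
  obtain ⟨g, hg, H⟩ := hp
  have hf : Computable₂ fun (a : α) (n : ℕ) => g (a, n.unpair.1) n.unpair.2 := by
    refine hg.comp (Computable.fst.pair ?_) ?_
    · exact Computable.fst.comp (Computable.unpair.comp Computable.snd)
    · exact Computable.snd.comp (Computable.unpair.comp Computable.snd)
  obtain ⟨f, hf, hgf, -⟩ := hf.exists_least fun a => by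
    obtain ⟨n, hn⟩ := ht a
    obtain ⟨m, hm⟩ := (H _).1 hn
    exact ⟨Nat.pair n m, by simpa using hm⟩
  exact ⟨fun a => (f a).unpair.1, Computable.fst.comp (Computable.unpair.comp hf),
    fun a => (H _).2 ⟨_, hgf a⟩⟩

end IsSemidecidable

/-- Running a program with bounded fuel is a primitive recursive test, and a program has a given
value exactly when some amount of fuel yields it. -/
theorem isSemidecidable_mem_eval :
    IsSemidecidable fun a : (Nat.Partrec.Code × ℕ) × ℕ => a.2 ∈ a.1.1.eval a.1.2 := by
  refine ⟨fun a k => decide (Nat.Partrec.Code.evaln k a.1.1 a.1.2 = some a.2), ?_, fun a => ?_⟩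
  · refine (Primrec.eq.decide.to_comp).comp (Nat.Partrec.Code.primrec_evaln.to_comp.comp
      ((Computable.snd.pair ?_).pair ?_)) (Computable.option_some.comp ?_)
    · exact Computable.fst.comp (Computable.fst.comp Computable.fst)
    · exact Computable.snd.comp (Computable.fst.comp Computable.fst)
    · exact Computable.snd.comp Computable.fst
  · simp only [decide_eq_true_eq]
    exact Nat.Partrec.Code.evaln_complete

theorem Partrec.isSemidecidable_mem {φ : ℕ →. ℕ} (hφ : Partrec φ) :
    IsSemidecidable fun a : ℕ × ℕ => a.2 ∈ φ a.1 := by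
  obtain ⟨c, rfl⟩ := Nat.Partrec.Code.exists_code.1 (Partrec.nat_iff.1 hφ)
  exact isSemidecidable_mem_eval.comp
    (((Computable.const c).pair Computable.fst).pair Computable.snd)

/-! ### Comparison of computable reals with dyadic rationals -/

theorem scalarOfNat_real (n : ℕ) : scalarOfNat ℝ n = (ratOfNat n.unpair.1 : ℝ) := by
  simp [scalarOfNat]

/-- Clearing denominators and moving negative terms across leaves a comparison of natural numbers,
which is visibly decidable by a computable function. -/
theorem ratOfNat_add_lt_iff (n m s : ℕ) :
    (ratOfNat n : ℝ) + (2 : ℝ)⁻¹ ^ m < (2 : ℝ)⁻¹ ^ s ↔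
      n.unpair.1.unpair.1 * 2 ^ (m + s) + (n.unpair.2 + 1) * 2 ^ s <
        (n.unpair.2 + 1) * 2 ^ m + n.unpair.1.unpair.2 * 2 ^ (m + s) := by
  rw [← Nat.cast_lt (α := ℝ)]
  generalize hA : n.unpair.1.unpair.1 = A
  generalize hB : n.unpair.1.unpair.2 = B
  generalize hC : n.unpair.2 = C
  simp only [ratOfNat, hA, hB, hC]
  push_cast
  have hC0 : (0 : ℝ) < C + 1 := by positivity
  have h1 : (0 : ℝ) < 2 ^ m := by positivity
  have h2 : (0 : ℝ) < 2 ^ s := by positivity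
  rw [← mul_lt_mul_iff_left₀ (show (0 : ℝ) < (C + 1) * (2 ^ m * 2 ^ s) by positivity)]
  have e1 : (((A : ℝ) - B) / (C + 1) + 2⁻¹ ^ m) * ((C + 1) * (2 ^ m * 2 ^ s)) =
      ((A : ℝ) - B) * 2 ^ (m + s) + (C + 1) * 2 ^ s := by
    rw [inv_pow, pow_add]; field_simp
  have e2 : (2⁻¹ : ℝ) ^ s * ((C + 1) * (2 ^ m * 2 ^ s)) = (C + 1) * 2 ^ m := by
    rw [inv_pow]; field_simp
  rw [e1, e2]
  constructor <;> intro h <;> linarith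

theorem lt_ratOfNat_sub_iff (n m s : ℕ) :
    (2 : ℝ)⁻¹ ^ s < (ratOfNat n : ℝ) - (2 : ℝ)⁻¹ ^ m ↔
      (n.unpair.2 + 1) * 2 ^ m + (n.unpair.1.unpair.2 * 2 ^ (m + s) + (n.unpair.2 + 1) * 2 ^ s) <
        n.unpair.1.unpair.1 * 2 ^ (m + s) := by
  rw [← Nat.cast_lt (α := ℝ)]
  generalize hA : n.unpair.1.unpair.1 = A
  generalize hB : n.unpair.1.unpair.2 = B
  generalize hC : n.unpair.2 = C
  simp only [ratOfNat, hA, hB, hC]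
  push_cast
  have hC0 : (0 : ℝ) < C + 1 := by positivity
  have h1 : (0 : ℝ) < 2 ^ m := by positivity
  have h2 : (0 : ℝ) < 2 ^ s := by positivity
  rw [← mul_lt_mul_iff_left₀ (show (0 : ℝ) < (C + 1) * (2 ^ m * 2 ^ s) by positivity)]
  have e1 : (((A : ℝ) - B) / (C + 1) - 2⁻¹ ^ m) * ((C + 1) * (2 ^ m * 2 ^ s)) =
      ((A : ℝ) - B) * 2 ^ (m + s) - (C + 1) * 2 ^ s := by
    rw [inv_pow, pow_add]; field_simp
  have e2 : (2⁻¹ : ℝ) ^ s * ((C + 1) * (2 ^ m * 2 ^ s)) = (C + 1) * 2 ^ m := by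
    rw [inv_pow]; field_simp
  rw [e1, e2]
  constructor <;> intro h <;> linarith

section

variable {α : Type*} [Primcodable α] {f g : α → ℕ}

theorem Computable.nat_add (hf : Computable f) (hg : Computable g) :
    Computable fun a => f a + g a :=
  Primrec.nat_add.to_comp.comp hf hg

theorem Computable.nat_mul (hf : Computable f) (hg : Computable g) :
    Computable fun a => f a * g a :=
  Primrec.nat_mul.to_comp.comp hf hg

theorem Computable.two_pow (hf : Computable f) : Computable fun a => 2 ^ f a :=
  (Primrec₂.unpaired'.1 Nat.Primrec.pow).to_comp.comp (Computable.const 2) hf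

theorem Computable.nat_lt (hf : Computable f) (hg : Computable g) :
    Computable fun a => decide (f a < g a) :=
  Primrec.nat_lt.decide.to_comp.comp hf hg

theorem Computable.unpair_fst (hf : Computable f) : Computable fun a => (f a).unpair.1 :=
  Computable.fst.comp (Computable.unpair.comp hf)

theorem Computable.unpair_snd (hf : Computable f) : Computable fun a => (f a).unpair.2 :=
  Computable.snd.comp (Computable.unpair.comp hf)

end

theorem exists_inv_two_pow_lt {r : ℝ} (hr : 0 < r) : ∃ m : ℕ, (2 : ℝ)⁻¹ ^ m < r :=
  exists_pow_lt_of_lt_one hr (by norm_num)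

theorem IsComputableFamily.isSemidecidable_lt {ι : Type*} [Primcodable ι] {c : ι → ℝ}
    (hc : IsComputableFamily c) :
    IsSemidecidable fun a : ι × ℕ => c a.1 < (2 : ℝ)⁻¹ ^ a.2 := by
  obtain ⟨f, hf, hfc⟩ := hc
  refine ⟨fun a m => decide ((ratOfNat (f (a.1, m)).unpair.1 : ℝ) + (2 : ℝ)⁻¹ ^ m <
    (2 : ℝ)⁻¹ ^ a.2), ?_, fun a => ?_⟩
  · simp only [ratOfNat_add_lt_iff]
    have hn : Computable fun x : (ι × ℕ) × ℕ => (f (x.1.1, x.2)).unpair.1 :=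
      (hf.comp ((Computable.fst.comp Computable.fst).pair Computable.snd)).unpair_fst
    have hs : Computable fun x : (ι × ℕ) × ℕ => x.1.2 := Computable.snd.comp Computable.fst
    have hC := hn.unpair_snd.nat_add (Computable.const 1)
    have hp := (Computable.snd.nat_add hs).two_pow
    refine Computable.nat_lt (.nat_add (.nat_mul ?_ hp) (.nat_mul hC hs.two_pow))
      (.nat_add (.nat_mul hC Computable.snd.two_pow) (.nat_mul ?_ hp))
    · exact hn.unpair_fst.unpair_fst
    · exact hn.unpair_fst.unpair_snd
  · simp only [decide_eq_true_eq]
    constructor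
    · intro h
      -- Half the gap, since the error `2⁻ᵐ` enters twice: in the approximation and in the test.
      obtain ⟨m, hm⟩ := exists_inv_two_pow_lt (half_pos (sub_pos.2 h))
      refine ⟨m, ?_⟩
      have := (abs_le.1 (hfc a.1 m)).2
      rw [scalarOfNat_real] at this
      linarith
    · rintro ⟨m, hm⟩
      have := (abs_le.1 (hfc a.1 m)).1
      rw [scalarOfNat_real] at this
      linarith

theorem IsComputableFamily.isSemidecidable_gt {ι : Type*} [Primcodable ι] {c : ι → ℝ}
    (hc : IsComputableFamily c) :
    IsSemidecidable fun a : ι × ℕ => (2 : ℝ)⁻¹ ^ a.2 < c a.1 := by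
  obtain ⟨f, hf, hfc⟩ := hc
  refine ⟨fun a m => decide ((2 : ℝ)⁻¹ ^ a.2 <
    (ratOfNat (f (a.1, m)).unpair.1 : ℝ) - (2 : ℝ)⁻¹ ^ m), ?_, fun a => ?_⟩
  · simp only [lt_ratOfNat_sub_iff]
    have hn : Computable fun x : (ι × ℕ) × ℕ => (f (x.1.1, x.2)).unpair.1 :=
      (hf.comp ((Computable.fst.comp Computable.fst).pair Computable.snd)).unpair_fst
    have hs : Computable fun x : (ι × ℕ) × ℕ => x.1.2 := Computable.snd.comp Computable.fst
    have hC := hn.unpair_snd.nat_add (Computable.const 1)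
    have hp := (Computable.snd.nat_add hs).two_pow
    refine Computable.nat_lt (.nat_add (.nat_mul hC Computable.snd.two_pow)
      (.nat_add (.nat_mul ?_ hp) (.nat_mul hC hs.two_pow))) (.nat_mul ?_ hp)
    · exact hn.unpair_fst.unpair_snd
    · exact hn.unpair_fst.unpair_fst
  · simp only [decide_eq_true_eq]
    constructor
    · intro h
      obtain ⟨m, hm⟩ := exists_inv_two_pow_lt (half_pos (sub_pos.2 h))
      refine ⟨m, ?_⟩
      have := (abs_le.1 (hfc a.1 m)).1
      rw [scalarOfNat_real] at this
      linarith
    · rintro ⟨m, hm⟩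
      have := (abs_le.1 (hfc a.1 m)).2
      rw [scalarOfNat_real] at this
      linarith

/-! ### Rational scalars -/

theorem ratOfNat_surjective : Function.Surjective ratOfNat := by
  intro q
  refine ⟨Nat.pair (Nat.pair q.num.toNat (-q.num).toNat) (q.den - 1), ?_⟩
  have h1 : ((q.num.toNat : ℚ) - ((-q.num).toNat : ℚ)) = q.num := by
    exact_mod_cast Int.toNat_sub_toNat_neg q.num
  have h2 : ((q.den - 1 : ℕ) : ℚ) + 1 = q.den := by
    exact_mod_cast Nat.sub_add_cancel q.den_pos
  simp only [ratOfNat, Nat.unpair_pair, h1, h2]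
  exact Rat.num_div_den q

theorem scalarOfNat_zero (𝕜 : Type*) [RCLike 𝕜] : scalarOfNat 𝕜 0 = 0 := by
  simp [scalarOfNat, ratOfNat]

theorem exists_scalarOfNat_eq (𝕜 : Type*) [RCLike 𝕜] (q r : ℚ) :
    ∃ n, scalarOfNat 𝕜 n = (q : 𝕜) + (r : 𝕜) * RCLike.I := by
  obtain ⟨m, rfl⟩ := ratOfNat_surjective q
  obtain ⟨n, rfl⟩ := ratOfNat_surjective r
  exact ⟨Nat.pair m n, by simp [scalarOfNat]⟩

theorem exists_scalarOfNat_eq_rat (𝕜 : Type*) [RCLike 𝕜] (q : ℚ) :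
    ∃ n, scalarOfNat 𝕜 n = (q : 𝕜) := by
  simpa using exists_scalarOfNat_eq 𝕜 q 0

theorem denseRange_scalarOfNat (𝕜 : Type*) [RCLike 𝕜] : DenseRange (scalarOfNat 𝕜) := by
  have h : DenseRange fun p : ℚ × ℚ => ((p.1 : 𝕜) + (p.2 : 𝕜) * RCLike.I) := by
    have h1 : DenseRange (Prod.map ((↑) : ℚ → ℝ) ((↑) : ℚ → ℝ)) :=
      Rat.isDenseEmbedding_coe_real.dense.prodMap Rat.isDenseEmbedding_coe_real.dense
    have h2 : Function.Surjective fun p : ℝ × ℝ => ((p.1 : 𝕜) + (p.2 : 𝕜) * RCLike.I) :=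
      fun z => ⟨(RCLike.re z, RCLike.im z), RCLike.re_add_im z⟩
    have h3 := h2.denseRange.comp h1 (by fun_prop)
    convert h3 using 2 with p
    simp
  refine h.mono ?_
  rintro _ ⟨p, rfl⟩
  exact exists_scalarOfNat_eq 𝕜 p.1 p.2

/-! ### Computable families of scalars -/

theorem IsComputableFamily.comp {𝕜 ι κ : Type*} [RCLike 𝕜] [Primcodable ι] [Primcodable κ]
    {c : ι → 𝕜} (hc : IsComputableFamily c) {f : κ → ι} (hf : Computable f) :
    IsComputableFamily fun k => c (f k) := by
  obtain ⟨g, hg, h⟩ := hc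
  exact ⟨fun p => g (f p.1, p.2), hg.comp ((hf.comp Computable.fst).pair Computable.snd),
    fun k m => h (f k) m⟩

theorem isComputableFamily_scalarOfNat (𝕜 : Type*) {ι : Type*} [RCLike 𝕜] [Primcodable ι]
    {f : ι → ℕ} (hf : Computable f) : IsComputableFamily fun i => scalarOfNat 𝕜 (f i) :=
  ⟨fun p => f p.1, hf.comp Computable.fst, fun i m => by simp⟩

theorem isComputableScalar_scalarOfNat {𝕜 : Type*} [RCLike 𝕜] (n : ℕ) :
    IsComputableScalar (scalarOfNat 𝕜 n) :=
  isComputableFamily_scalarOfNat 𝕜 (Computable.const n)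

theorem isComputableScalar_rat {𝕜 : Type*} [RCLike 𝕜] (q : ℚ) : IsComputableScalar (q : 𝕜) := by
  obtain ⟨n, hn⟩ := exists_scalarOfNat_eq_rat 𝕜 q
  exact hn ▸ isComputableScalar_scalarOfNat n

theorem isComputableScalar_zero {𝕜 : Type*} [RCLike 𝕜] : IsComputableScalar (0 : 𝕜) := by
  simpa using isComputableScalar_rat (𝕜 := 𝕜) 0

theorem isComputableScalar_one {𝕜 : Type*} [RCLike 𝕜] : IsComputableScalar (1 : 𝕜) := by
  simpa using isComputableScalar_rat (𝕜 := 𝕜) 1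

/-! ### Computable sequences -/

theorem Computable.ite_eq {α : Type*} [Primcodable α] {f g q r : α → ℕ} (hf : Computable f)
    (hg : Computable g) (hq : Computable q) (hr : Computable r) :
    Computable fun a => if f a = g a then q a else r a := by
  have h : Computable fun a => decide (f a = g a) := Primrec.eq.decide.to_comp.comp hf hg
  exact (Computable.cond h hq hr).of_eq fun a => Bool.cond_decide _ _ _

namespace ComputabilityStructure

variable {𝕜 X : Type*} [RCLike 𝕜] [NormedAddCommGroup X] [NormedSpace 𝕜 X]
  (S : ComputabilityStructure 𝕜 X)

/-- Kronecker-delta coefficients in the linear combination axiom select the terms `f n` and `g n`;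
the summation bound `f n + g n` covers both. All reindexing of computable sequences rests on this.
-/
theorem smul_comp_add_smul_comp_mem {x y : ℕ → X} (hx : x ∈ S.seqs) (hy : y ∈ S.seqs)
    {f g q r : ℕ → ℕ} (hf : Computable f) (hg : Computable g) (hq : Computable q)
    (hr : Computable r) :
    (fun n => scalarOfNat 𝕜 (q n) • x (f n) + scalarOfNat 𝕜 (r n) • y (g n)) ∈ S.seqs := by
  have key : ∀ {f q : ℕ → ℕ}, Computable f → Computable q →
      IsComputableFamily fun p : ℕ × ℕ => scalarOfNat 𝕜 (if f p.1 = p.2 then q p.1 else 0) :=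
    fun hf hq => isComputableFamily_scalarOfNat 𝕜 <| Computable.ite_eq
      (hf.comp Computable.fst) Computable.snd (hq.comp Computable.fst) (Computable.const 0)
  have h := S.linear x hx y hy _ _ (key hf hq) (key hg hr) (fun n => f n + g n) (hf.nat_add hg)
  convert h using 2 with n
  have hite : ∀ (u v k : ℕ) (z : ℕ → X), scalarOfNat 𝕜 (if u = k then v else 0) • z k =
      if u = k then scalarOfNat 𝕜 v • z k else 0 := by
    intro u v k z
    split_ifs
    · rfl
    · rw [scalarOfNat_zero, zero_smul]
  simp only [Finset.sum_add_distrib, hite, Finset.sum_ite_eq, Finset.mem_range]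
  rw [if_pos (by omega), if_pos (by omega)]

theorem comp_sub_comp_mem {x y : ℕ → X} (hx : x ∈ S.seqs) (hy : y ∈ S.seqs)
    {f g : ℕ → ℕ} (hf : Computable f) (hg : Computable g) :
    (fun n => x (f n) - y (g n)) ∈ S.seqs := by
  obtain ⟨p, hp⟩ := exists_scalarOfNat_eq_rat 𝕜 1
  obtain ⟨m, hm⟩ := exists_scalarOfNat_eq_rat 𝕜 (-1)
  have h := S.smul_comp_add_smul_comp_mem hx hy hf hg (Computable.const p) (Computable.const m)
  simpa [hp, hm, sub_eq_add_neg] using h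

theorem zero_mem_elements : (0 : X) ∈ S.elements := by
  obtain ⟨x, hx⟩ := S.nonempty
  have h := S.comp_sub_comp_mem hx hx (Computable.const 0) (Computable.const 0)
  simpa [elements] using h

theorem apply_mem_elements {x : ℕ → X} (hx : x ∈ S.seqs) (m : ℕ) : x m ∈ S.elements := by
  have h := S.comp_sub_comp_mem hx S.zero_mem_elements (Computable.const m) (Computable.const 0)
  simpa [elements] using h

/-- Prepending a computable element to a computable sequence. -/
theorem cases_mem {x : X} (hx : x ∈ S.elements) {y : ℕ → X} (hy : y ∈ S.seqs) :
    (fun n => Nat.casesOn n x y : ℕ → X) ∈ S.seqs := by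
  obtain ⟨p, hp⟩ := exists_scalarOfNat_eq_rat 𝕜 1
  -- The coefficients are the indicators of `n = 0` and `n ≠ 0`, so the value of `pred` at `0` is
  -- irrelevant.
  have h := S.smul_comp_add_smul_comp_mem hx hy (Computable.const 0) Computable.pred
    (Computable.ite_eq Computable.id (Computable.const 0) (Computable.const p) (Computable.const 0))
    (Computable.ite_eq Computable.id (Computable.const 0) (Computable.const 0) (Computable.const p))
  convert h using 2 with n
  cases n <;> simp [hp, scalarOfNat_zero]

theorem isComputableFamily_norm_sub {x y : ℕ → X} (hx : x ∈ S.seqs) (hy : y ∈ S.seqs) :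
    IsComputableFamily fun p : ℕ × ℕ => ‖x p.1 - y p.2‖ := by
  have h := S.norm _ (S.comp_sub_comp_mem hx hy (Computable.fst.comp Computable.unpair)
    (Computable.snd.comp Computable.unpair))
  simpa using h.comp (Primrec₂.natPair.to_comp : Computable fun p : ℕ × ℕ => Nat.pair p.1 p.2)

theorem ratSpanSeq_mem {e : ℕ → X} (he : e ∈ S.seqs) : ratSpanSeq 𝕜 e ∈ S.seqs := by
  have hl : Computable fun n : ℕ => (Encodable.decode (α := List ℕ) n).getD [] :=
    Computable.option_getD Computable.decode (Computable.const [])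
  have ha : IsComputableFamily fun p : ℕ × ℕ =>
      scalarOfNat 𝕜 (((Encodable.decode (α := List ℕ) p.1).getD []).getD p.2 0) :=
    isComputableFamily_scalarOfNat 𝕜
      ((Primrec.list_getD 0).to_comp.comp (hl.comp Computable.fst) Computable.snd)
  have hb : IsComputableFamily fun _ : ℕ × ℕ => scalarOfNat 𝕜 0 :=
    isComputableFamily_scalarOfNat 𝕜 (Computable.const 0)
  -- The axiom sums one term past the end of the list; there `getD` returns `0`, which codes the
  -- scalar `0`.
  have h := S.linear e he e he _ _ ha hb _ (Computable.list_length.comp hl)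
  convert h using 2 with n
  simp [ratSpanSeq, Finset.sum_range_succ, scalarOfNat_zero]

theorem denseRange_ratSpanSeq {e : ℕ → X}
    (he : Dense (Submodule.span 𝕜 (Set.range e) : Set X)) : DenseRange (ratSpanSeq 𝕜 e) := by
  refine dense_closure.1 (he.mono fun x hx => ?_)
  obtain ⟨c, rfl⟩ := Finsupp.mem_span_range_iff_exists_finsupp.1 hx
  -- Codes describe coefficients on initial segments, so the support is padded to one.
  obtain ⟨n, hn⟩ := c.support.exists_nat_subset_range
  rw [Finsupp.sum_of_support_subset _ hn _ (by simp), Finset.sum_range]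
  have hd : DenseRange (Pi.map fun (_ : Fin n) => scalarOfNat 𝕜) :=
    DenseRange.piMap fun _ => denseRange_scalarOfNat 𝕜
  have hc : Continuous fun v : Fin n → 𝕜 => ∑ k, v k • e k := by fun_prop
  have hm := map_mem_closure hc (hd fun k => c k) (Set.mapsTo_image _ _)
  refine closure_mono ?_ hm
  rintro _ ⟨_, ⟨v, rfl⟩, rfl⟩
  refine ⟨Encodable.encode (List.ofFn v), ?_⟩
  simp only [ratSpanSeq, Encodable.encodek, Option.getD_some, List.length_ofFn, Finset.sum_range]
  simp

/-- Every computable sequence is effectively approximated by the rational span. -/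
theorem exists_computable_approx {e : ℕ → X} (he : S.IsEGS e) {b : ℕ → X} (hb : b ∈ S.seqs) :
    ∃ p : ℕ × ℕ → ℕ, Computable p ∧
      ∀ m n, ‖ratSpanSeq 𝕜 e (p (m, n)) - b m‖ < (2 : ℝ)⁻¹ ^ n := by
  have h := (S.isComputableFamily_norm_sub (S.ratSpanSeq_mem he.1) hb).isSemidecidable_lt
  have h' : IsSemidecidable fun a : (ℕ × ℕ) × ℕ =>
      ‖ratSpanSeq 𝕜 e a.2 - b a.1.1‖ < (2 : ℝ)⁻¹ ^ a.1.2 :=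
    h.comp (f := fun a : (ℕ × ℕ) × ℕ => ((a.2, a.1.1), a.1.2))
      ((Computable.snd.pair (Computable.fst.comp Computable.fst)).pair
        (Computable.snd.comp Computable.fst))
  obtain ⟨p, hp, H⟩ := h'.exists_computable_choice fun a => by
    obtain ⟨n, hn⟩ := (denseRange_ratSpanSeq he.2).exists_dist_lt (b a.1)
      (show (0 : ℝ) < 2⁻¹ ^ a.2 by positivity)
    exact ⟨n, by rwa [dist_comm, dist_eq_norm] at hn⟩
  exact ⟨p, hp, fun m n => H (m, n)⟩

end ComputabilityStructure

/-! ### Continuity of effective operators -/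

namespace ComputabilityStructure

variable {𝕜 X : Type*} [RCLike 𝕜] [NormedAddCommGroup X] [NormedSpace 𝕜 X]
  (S : ComputabilityStructure 𝕜 X)

/-- Up to a given precision, the approximations of `T x` that an effective operator produces from
the standard indices of `x` form a semidecidable relation. -/
theorem exists_semidecidable_approx {e : ℕ → X} {T : S.elements → S.elements}
    (heff : S.IsEffective e T) (k : ℕ) :
    ∃ W : ℕ × ℕ → Prop, IsSemidecidable W ∧
      ∀ (i : ℕ) (x : S.elements), IsStandardIndex 𝕜 e i (x : X) →
        (∃ w, W (i, w)) ∧ ∀ w, W (i, w) → ‖ratSpanSeq 𝕜 e w - T x‖ < (2 : ℝ)⁻¹ ^ k := by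
  obtain ⟨φ, hφ, H⟩ := heff
  -- `W (i, w)` says that program number `φ i` outputs `w` at argument `k`. Single-valuedness rules
  -- out any other `w`.
  refine ⟨fun a => ∃ j, j ∈ φ a.1 ∧ a.2 ∈ (Denumerable.ofNat Nat.Partrec.Code j).eval k, ?_, ?_⟩
  · refine IsSemidecidable.exists_nat
      (p := fun a : (ℕ × ℕ) × ℕ => a.2 ∈ φ a.1.1 ∧
        a.1.2 ∈ (Denumerable.ofNat Nat.Partrec.Code a.2).eval k)
      (.and (hφ.isSemidecidable_mem.comp (f := fun a : (ℕ × ℕ) × ℕ => (a.1.1, a.2)) ?_)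
        (isSemidecidable_mem_eval.comp (f := fun a : (ℕ × ℕ) × ℕ =>
          ((Denumerable.ofNat Nat.Partrec.Code a.2, k), a.1.2)) ?_))
    · exact (Computable.fst.comp Computable.fst).pair Computable.snd
    · exact (((Computable.ofNat _).comp Computable.snd).pair (Computable.const k)).pair
        (Computable.snd.comp Computable.fst)
  · intro i x hx
    obtain ⟨j, hj, hT⟩ := H i x hx
    obtain ⟨m, hm, hlt⟩ := hT k
    refine ⟨⟨m, j, hj, hm⟩, ?_⟩
    rintro w ⟨j', hj', hw⟩
    obtain rfl := Part.mem_unique hj hj'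
    obtain rfl := Part.mem_unique hm hw
    exact hlt

/-- A computable family of approximations yields a computable family of standard indices. -/
theorem _root_.exists_computable_standardIndex {e b : ℕ → X} {p : ℕ × ℕ → ℕ} (hp : Computable p)
    (hpb : ∀ m n, ‖ratSpanSeq 𝕜 e (p (m, n)) - b m‖ < (2 : ℝ)⁻¹ ^ n) :
    ∃ idx : ℕ → ℕ, Computable idx ∧ ∀ m, IsStandardIndex 𝕜 e (idx m) (b m) := by
  -- The s-m-n theorem freezes `m` in a program for `p`.
  obtain ⟨s, hs, hse⟩ := Nat.Partrec.Code.smn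
  obtain ⟨c, hc⟩ := Nat.Partrec.Code.exists_code.1
    (Partrec.nat_iff.1 (hp.comp Computable.unpair).partrec)
  refine ⟨fun m => Encodable.encode (s c m),
    Computable.encode.comp (hs.comp (Computable.const c) Computable.id), fun m n => ?_⟩
  refine ⟨p (m, n), ?_, hpb m n⟩
  rw [Denumerable.ofNat_encode, hse, hc]
  simp

/-- Effective operators are continuous along computable sequences. The proof is by
self-reference: a program enumerates approximations of `b 0` until it sees an approximation of
the value of `T` at its own output, and then turns to a nearby `b m` that refutes that value. -/
theorem exists_norm_sub_le_of_isEffective {e : ℕ → X} (he : S.IsEGS e)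
    {T : S.elements → S.elements} (heff : S.IsEffective e T) {b : ℕ → X} (hb : b ∈ S.seqs)
    (N : ℕ) :
    ∃ s : ℕ, ∀ m, ‖b m - b 0‖ < (2 : ℝ)⁻¹ ^ s →
      ‖(T ⟨b m, S.apply_mem_elements hb m⟩ : X) - T ⟨b 0, S.apply_mem_elements hb 0⟩‖ ≤
        4 * (2 : ℝ)⁻¹ ^ N := by
  by_contra! hcon
  set B : ℕ → S.elements := fun m => ⟨b m, S.apply_mem_elements hb m⟩ with hB
  change ∀ s : ℕ, ∃ m, ‖b m - b 0‖ < (2 : ℝ)⁻¹ ^ s ∧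
    4 * (2 : ℝ)⁻¹ ^ N < ‖(T (B m) : X) - T (B 0)‖ at hcon
  obtain ⟨p, hp, hpb⟩ := S.exists_computable_approx he hb
  obtain ⟨idx, hidx, hidxb⟩ := exists_computable_standardIndex (𝕜 := 𝕜) hp hpb
  -- Precision `N + 1`: two approximations of the same value then differ by less than `2⁻ᴺ`.
  obtain ⟨W, hW, HW⟩ := S.exists_semidecidable_approx heff (N + 1)
  have hN : (2 : ℝ)⁻¹ ^ (N + 1) = 2⁻¹ ^ N / 2 := by rw [pow_succ]; ring
  have hN0 : (0 : ℝ) < 2⁻¹ ^ N := by positivity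
  have ha := S.ratSpanSeq_mem he.1
  -- points near `b 0` whose image under `T` is far from a given approximation
  obtain ⟨H, hHc, hH⟩ : ∃ H : ℕ × ℕ → ℕ, Computable H ∧
      ∀ q : ℕ × ℕ, ‖b (H q) - b 0‖ < (2 : ℝ)⁻¹ ^ q.1 ∧
        ∃ w, W (idx (H q), w) ∧
          (2 : ℝ)⁻¹ ^ N < ‖ratSpanSeq 𝕜 e w - ratSpanSeq 𝕜 e q.2‖ := by
    refine IsSemidecidable.exists_computable_choice
      (p := fun a : (ℕ × ℕ) × ℕ => ‖b a.2 - b 0‖ < (2 : ℝ)⁻¹ ^ a.1.1 ∧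
        ∃ w, W (idx a.2, w) ∧
          (2 : ℝ)⁻¹ ^ N < ‖ratSpanSeq 𝕜 e w - ratSpanSeq 𝕜 e a.1.2‖) ?_ ?_
    · refine .and ((S.isComputableFamily_norm_sub hb hb).isSemidecidable_lt.comp
          (f := fun a : (ℕ × ℕ) × ℕ => ((a.2, 0), a.1.1)) ?_)
        (IsSemidecidable.exists_nat (p := fun a : ((ℕ × ℕ) × ℕ) × ℕ => W (idx a.1.2, a.2) ∧
          (2 : ℝ)⁻¹ ^ N < ‖ratSpanSeq 𝕜 e a.2 - ratSpanSeq 𝕜 e a.1.1.2‖)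
          (.and (hW.comp (f := fun a : ((ℕ × ℕ) × ℕ) × ℕ => (idx a.1.2, a.2)) ?_)
          ((S.isComputableFamily_norm_sub ha ha).isSemidecidable_gt.comp
            (f := fun a : ((ℕ × ℕ) × ℕ) × ℕ => ((a.2, a.1.1.2), N)) ?_)))
      · exact (Computable.snd.pair (Computable.const 0)).pair (Computable.fst.comp Computable.fst)
      · exact (hidx.comp (Computable.snd.comp Computable.fst)).pair Computable.snd
      · exact (Computable.snd.pair (Computable.snd.comp (Computable.fst.comp
          Computable.fst))).pair (Computable.const N)
    · rintro ⟨s, v⟩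
      have far : ∀ m, 2 * (2 : ℝ)⁻¹ ^ N < ‖(T (B m) : X) - ratSpanSeq 𝕜 e v‖ →
          ∃ w, W (idx m, w) ∧ (2 : ℝ)⁻¹ ^ N < ‖ratSpanSeq 𝕜 e w - ratSpanSeq 𝕜 e v‖ := by
        intro m hm
        obtain ⟨⟨w, hw⟩, h⟩ := HW (idx m) (B m) (hidxb m)
        refine ⟨w, hw, ?_⟩
        have h1 := h w hw
        have h2 := norm_sub_le_norm_sub_add_norm_sub (T (B m) : X) (ratSpanSeq 𝕜 e w)
          (ratSpanSeq 𝕜 e v)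
        rw [norm_sub_rev (T (B m) : X) (ratSpanSeq 𝕜 e w)] at h2
        linarith
      -- Values more than `4 * 2⁻ᴺ` apart cannot both lie within `2 * 2⁻ᴺ` of `a_v`. The search need
      -- not decide which case holds.
      by_cases h0 : 2 * (2 : ℝ)⁻¹ ^ N < ‖(T (B 0) : X) - ratSpanSeq 𝕜 e v‖
      · exact ⟨0, by simp, far 0 h0⟩
      · obtain ⟨m, hm, hTm⟩ := hcon s
        refine ⟨m, hm, far m ?_⟩
        have h2 := norm_sub_le_norm_sub_add_norm_sub (T (B m) : X) (ratSpanSeq 𝕜 e v) (T (B 0) : X)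
        rw [norm_sub_rev (ratSpanSeq 𝕜 e v) (T (B 0) : X)] at h2
        linarith
  obtain ⟨g, hg, hgW⟩ := hW
  -- the first stage up to `n` at which the program `c` sees the value of `T` at its own output
  obtain ⟨u, hu, hu1, hu2⟩ : ∃ u : Nat.Partrec.Code × ℕ → ℕ, Computable u ∧
      (∀ a, (g (Encodable.encode a.1, (u a).unpair.1) (u a).unpair.2 ||
        decide (a.2 < u a)) = true) ∧
      ∀ a, ∀ m < u a, (g (Encodable.encode a.1, m.unpair.1) m.unpair.2 ||
        decide (a.2 < m)) = false := by
    -- The disjunct `n < m` makes the search total: it returns `n + 1` if no stage up to `n`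
    -- succeeds. A stage codes a pair of a candidate `w` and a search bound for `W`.
    refine Computable₂.exists_least (g := fun (a : Nat.Partrec.Code × ℕ) (m : ℕ) =>
      g (Encodable.encode a.1, m.unpair.1) m.unpair.2 || decide (a.2 < m)) ?_
      fun a => ⟨a.2 + 1, by simp⟩
    refine Primrec.or.to_comp.comp (hg.comp (.pair ?_ ?_) ?_) (.nat_lt ?_ ?_)
    · exact Computable.encode.comp (Computable.fst.comp Computable.fst)
    · exact Computable.snd.unpair_fst
    · exact Computable.snd.unpair_snd
    · exact Computable.snd.comp Computable.fst
    · exact Computable.snd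
  -- Before the switch, precision `n + 1` reserves half of the tolerance `2⁻ⁿ` for moving from `b 0`
  -- to `b m`.
  have hF : Computable fun a : Nat.Partrec.Code × ℕ =>
      bif decide (a.2 < u a) then p (0, a.2 + 1) else p (H (u a, (u a).unpair.1), a.2) := by
    refine .cond (.nat_lt Computable.snd hu) (hp.comp (.pair (Computable.const 0) ?_))
      (hp.comp (.pair (hHc.comp (hu.pair hu.unpair_fst)) Computable.snd))
    exact Computable.succ.comp Computable.snd
  obtain ⟨c, hc⟩ := Nat.Partrec.Code.fixed_point₂
    (f := fun c n => Part.some (bif decide (n < u (c, n)) then p (0, n + 1) else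
      p (H (u (c, n), (u (c, n)).unpair.1), n))) hF.partrec.to₂
  have index : ∀ x : X, (∀ n, ‖ratSpanSeq 𝕜 e (bif decide (n < u (c, n)) then p (0, n + 1) else
      p (H (u (c, n), (u (c, n)).unpair.1), n)) - x‖ < (2 : ℝ)⁻¹ ^ n) →
      IsStandardIndex 𝕜 e (Encodable.encode c) x := by
    intro x hx n
    refine ⟨_, ?_, hx n⟩
    rw [Denumerable.ofNat_encode, hc]
    exact Part.mem_some _
  have half : ∀ n, (2 : ℝ)⁻¹ ^ (n + 1) = 2⁻¹ ^ n / 2 := fun n => by rw [pow_succ]; ring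
  -- If the switch never came, `c` would be an index of `b 0`, so `W` would hold for it and the
  -- search would succeed.
  have hex : ∃ k : ℕ, g (Encodable.encode c, k.unpair.1) k.unpair.2 = true := by
    by_contra! hno
    have hlt : ∀ n, n < u (c, n) := fun n => by simpa [hno] using hu1 (c, n)
    have hi : IsStandardIndex 𝕜 e (Encodable.encode c) (b 0) := index _ fun n => by
      rw [decide_eq_true (hlt n), cond_true]
      have h1 := hpb 0 (n + 1)
      have h2 : (0 : ℝ) < 2⁻¹ ^ n := by positivity
      rw [half] at h1
      linarith
    obtain ⟨⟨w, hw⟩, -⟩ := HW _ (B 0) hi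
    obtain ⟨t, ht⟩ := (hgW _).1 hw
    exact hno (Nat.pair w t) (by simpa using ht)
  classical
  set k := Nat.find hex with hk
  have hkg := Nat.find_spec hex
  rw [← hk] at hkg
  set m := H (k, k.unpair.1) with hm
  obtain ⟨hm1, w, hw, hwv⟩ := hH (k, k.unpair.1)
  rw [← hm] at hm1 hw
  have hi : IsStandardIndex 𝕜 e (Encodable.encode c) (b m) := index _ fun n => by
    by_cases hn : n < u (c, n)
    · rw [decide_eq_true hn, cond_true]
      have hnk : n < k := by
        by_contra! hle
        have := hu2 (c, n) k (hle.trans_lt hn)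
        simp [hkg] at this
      have h1 := hpb 0 (n + 1)
      have h2 : (2 : ℝ)⁻¹ ^ k ≤ 2⁻¹ ^ (n + 1) :=
        pow_le_pow_of_le_one (by norm_num) (by norm_num) hnk
      have h3 := norm_sub_le_norm_sub_add_norm_sub (ratSpanSeq 𝕜 e (p (0, n + 1))) (b 0) (b m)
      rw [norm_sub_rev (b 0)] at h3
      have h4 := half n
      simp only at hm1
      linarith
    · have hg1 := hu1 (c, n)
      rw [decide_eq_false hn, Bool.or_false] at hg1
      have huk : u (c, n) = k := by
        refine le_antisymm ?_ (Nat.find_min' hex hg1)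
        by_contra! hlt
        have := hu2 (c, n) k hlt
        simp [hkg] at this
      rw [decide_eq_false hn, cond_false, huk]
      exact hpb m n
  -- Both `encode c` and `idx m` are indices of `b m`, so the two approximations seen must be close,
  -- against the choice of `m`.
  have h1 := (HW _ (B m) hi).2 _ ((hgW _).2 ⟨_, hkg⟩)
  have h2 := (HW _ (B m) (hidxb m)).2 w hw
  have h3 := norm_sub_le_norm_sub_add_norm_sub (ratSpanSeq 𝕜 e w) (T (B m) : X)
    (ratSpanSeq 𝕜 e k.unpair.1)
  rw [norm_sub_rev (T (B m) : X)] at h3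
  simp only at hwv
  linarith

end ComputabilityStructure

/-! ### Extension of effective linear operators -/

namespace ComputabilityStructure

variable {𝕜 X : Type*} [RCLike 𝕜] [NormedAddCommGroup X] [NormedSpace 𝕜 X]
  (S : ComputabilityStructure 𝕜 X)

theorem exists_delta_ratSpanSeq {e : ℕ → X} (he : S.IsEGS e) {T : S.elements → S.elements}
    (heff : S.IsEffective e T) (x : S.elements) {ε : ℝ} (hε : 0 < ε) :
    ∃ δ > 0, ∀ m, ‖ratSpanSeq 𝕜 e m - x‖ < δ →
      ‖(T ⟨ratSpanSeq 𝕜 e m, S.apply_mem_elements (S.ratSpanSeq_mem he.1) m⟩ : X) - T x‖ < ε := by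
  obtain ⟨N, hN⟩ := exists_inv_two_pow_lt (show 0 < ε / 4 by positivity)
  obtain ⟨s, hs⟩ := S.exists_norm_sub_le_of_isEffective he heff
    (S.cases_mem x.2 (S.ratSpanSeq_mem he.1)) N
  -- Index `m + 1`, since the prepended `x` occupies index `0`.
  exact ⟨2⁻¹ ^ s, by positivity, fun m hm => (hs (m + 1) hm).trans_lt (by linarith)⟩

theorem dense_elements {e : ℕ → X} (he : S.IsEGS e) : Dense S.elements := by
  refine (denseRange_ratSpanSeq he.2).mono ?_
  rintro _ ⟨m, rfl⟩
  exact S.apply_mem_elements (S.ratSpanSeq_mem he.1) m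

/-- An effective operator that vanishes at `0` is bounded near `0`. -/
theorem exists_norm_apply_le_one {e : ℕ → X} (he : S.IsEGS e) {T : S.elements → S.elements}
    (heff : S.IsEffective e T) (h0 : (T ⟨0, S.zero_mem_elements⟩ : X) = 0) :
    ∃ δ > 0, ∀ x : S.elements, ‖(x : X)‖ < δ → ‖(T x : X)‖ ≤ 1 := by
  obtain ⟨δ, hδ, h⟩ := S.exists_delta_ratSpanSeq he heff ⟨0, S.zero_mem_elements⟩ one_pos
  refine ⟨δ, hδ, fun x hx => le_of_forall_pos_le_add fun ε hε => ?_⟩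
  obtain ⟨δ', hδ', h'⟩ := S.exists_delta_ratSpanSeq he heff x hε
  -- The second bound keeps `a_m` in the `δ`-ball about `0`; the first makes `T a_m` close to `T x`.
  obtain ⟨m, hm⟩ := (denseRange_ratSpanSeq he.2).exists_dist_lt (x : X)
    (lt_min hδ' (sub_pos.2 hx))
  rw [dist_comm, dist_eq_norm] at hm
  have h1 := h' m (hm.trans_le (min_le_left _ _))
  have h2 := hm.trans_le (min_le_right _ _)
  have h3 := norm_le_norm_add_norm_sub' (ratSpanSeq 𝕜 e m) (x : X)
  have h4 := h m (by simpa using (by linarith : ‖ratSpanSeq 𝕜 e m‖ < δ))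
  rw [h0, sub_zero] at h4
  have h5 := norm_le_norm_add_norm_sub
    (T ⟨ratSpanSeq 𝕜 e m, S.apply_mem_elements (S.ratSpanSeq_mem he.1) m⟩ : X) (T x : X)
  linarith

variable {S}

theorem IsLinearOperator.map_smul {T : S.elements → S.elements} (hT : S.IsLinearOperator T)
    {a : 𝕜} (ha : IsComputableScalar a) (x : S.elements) (h : a • (x : X) ∈ S.elements) :
    (T ⟨a • (x : X), h⟩ : X) = a • (T x : X) := by
  have := hT a 0 ha isComputableScalar_zero x x
  simpa using this

theorem IsLinearOperator.map_sub {T : S.elements → S.elements} (hT : S.IsLinearOperator T)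
    (x y : S.elements) (h : (x : X) - y ∈ S.elements) :
    (T ⟨(x : X) - y, h⟩ : X) = T x - T y := by
  have := hT 1 (-1) isComputableScalar_one (by simpa using isComputableScalar_rat (𝕜 := 𝕜) (-1)) x y
  simpa [← sub_eq_add_neg] using this

theorem smul_mem_elements {a : 𝕜} (ha : IsComputableScalar a) {x : X} (hx : x ∈ S.elements) :
    a • x ∈ S.elements := by
  simpa using S.lincomb_mem ha isComputableScalar_zero hx hx

theorem add_mem_elements {x y : X} (hx : x ∈ S.elements) (hy : y ∈ S.elements) :
    x + y ∈ S.elements := by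
  simpa using S.lincomb_mem (𝕜 := 𝕜) isComputableScalar_one isComputableScalar_one hx hy

theorem sub_mem_elements {x y : X} (hx : x ∈ S.elements) (hy : y ∈ S.elements) :
    x - y ∈ S.elements := by
  exact S.comp_sub_comp_mem hx hy (Computable.const 0) (Computable.const 0)

/-- An effective linear operator is bounded. -/
theorem IsLinearOperator.exists_bound {T : S.elements → S.elements} (hT : S.IsLinearOperator T)
    {e : ℕ → X} (he : S.IsEGS e) (heff : S.IsEffective e T) :
    ∃ C : ℝ, ∀ x : S.elements, ‖(T x : X)‖ ≤ C * ‖(x : X)‖ := by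
  have h0 : (T ⟨0, S.zero_mem_elements⟩ : X) = 0 := by
    have := hT.map_smul isComputableScalar_zero ⟨0, S.zero_mem_elements⟩
      (by simpa using S.zero_mem_elements)
    simpa using this
  obtain ⟨δ, hδ, h⟩ := S.exists_norm_apply_le_one he heff h0
  refine ⟨δ⁻¹ * ‖(2 : 𝕜)‖, fun x => ?_⟩
  by_cases hx : (x : X) = 0
  · obtain rfl : x = ⟨0, S.zero_mem_elements⟩ := Subtype.ext hx
    simp [h0]
  -- Powers of `2` are computable scalars, so rescaling stays in the domain of `T`.
  · obtain ⟨n, hn0, hn1, -, hn2⟩ := rescale_to_shell_zpow (c := (2 : 𝕜)) (by simp) hδ hx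
    have hc : IsComputableScalar ((2 : 𝕜) ^ n) := by
      simpa using isComputableScalar_rat (𝕜 := 𝕜) (2 ^ n)
    have h1 := h ⟨_, smul_mem_elements hc x.2⟩ hn1
    rw [hT.map_smul hc, norm_smul] at h1
    refine le_trans ?_ hn2
    rwa [← one_div, le_div_iff₀' (norm_pos_iff.2 hn0)]

/-- A bounded linear operator on the computable elements extends to a continuous linear map. -/
theorem IsLinearOperator.exists_extension [CompleteSpace X] {T : S.elements → S.elements}
    (hT : S.IsLinearOperator T) (hd : Dense S.elements) {C : ℝ}
    (hC : ∀ x : S.elements, ‖(T x : X)‖ ≤ C * ‖(x : X)‖) :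
    ∃ T' : X →L[𝕜] X, ∀ x : S.elements, T' (x : X) = T x := by
  have hu : UniformContinuous fun x : S.elements => (T x : X) := by
    refine (LipschitzWith.of_dist_le' (K := C) fun x y => ?_).uniformContinuous
    rw [dist_eq_norm, Subtype.dist_eq, dist_eq_norm,
      ← hT.map_sub x y (sub_mem_elements x.2 y.2)]
    exact hC ⟨_, sub_mem_elements x.2 y.2⟩
  have hi : IsUniformInducing ((↑) : S.elements → X) := isUniformInducing_val _
  have hdr : DenseRange ((↑) : S.elements → X) := hd.denseRange_val
  set F : X → X := (hi.isDenseInducing hdr).extend fun x : S.elements => (T x : X) with hF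
  have hFc : Continuous F := (uniformContinuous_uniformly_extend hi hdr hu).continuous
  have hFe : ∀ x : S.elements, F x = T x := fun x => uniformly_extend_of_ind hi hdr hu x
  have hadd : ∀ x y, F (x + y) = F x + F y := by
    intro x y
    refine hdr.induction_on₂ (p := fun x y => F (x + y) = F x + F y)
      (isClosed_eq (by fun_prop) (by fun_prop)) (fun x y => ?_) x y
    have := hT 1 1 isComputableScalar_one isComputableScalar_one x y
    simp only [one_smul] at this
    rw [hFe, hFe, ← this]
    exact hFe ⟨_, add_mem_elements x.2 y.2⟩
  have hsmul : ∀ (a : 𝕜) x, F (a • x) = a • F x := by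
    intro a x
    -- `T` commutes only with computable scalars, so a general `a` is reached as a limit of rational
    -- ones, and then `x` as a limit of computable elements.
    refine (denseRange_scalarOfNat 𝕜).induction_on
      (p := fun a => F (a • x) = a • F x) a (isClosed_eq (by fun_prop) (by fun_prop)) fun n => ?_
    refine hdr.induction_on
      (p := fun x => F (scalarOfNat 𝕜 n • x) = scalarOfNat 𝕜 n • F x) x
      (isClosed_eq (by fun_prop) (by fun_prop)) fun x => ?_
    have hn := isComputableScalar_scalarOfNat (𝕜 := 𝕜) n
    rw [hFe, ← hT.map_smul hn x (smul_mem_elements hn x.2)]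
    exact hFe ⟨_, smul_mem_elements hn x.2⟩
  exact ⟨⟨⟨⟨F, hadd⟩, hsmul⟩, hFc⟩, hFe⟩

end ComputabilityStructure

theorem theorem38 {𝕜 X : Type*} [RCLike 𝕜] [NormedAddCommGroup X] [NormedSpace 𝕜 X]
    [CompleteSpace X] (S : ComputabilityStructure 𝕜 X) (e : ℕ → X) (he : S.IsEGS e)
    (T : S.elements → S.elements) (hlin : S.IsLinearOperator T) (heff : S.IsEffective e T) :
    ∃! T' : X →L[𝕜] X, ∀ x : S.elements, T' (x : X) = (T x : X) := by
  obtain ⟨C, hC⟩ := hlin.exists_bound he heff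
  have hd := S.dense_elements he
  obtain ⟨T', hT'⟩ := hlin.exists_extension hd hC
  refine ⟨T', hT', fun U hU => ContinuousLinearMap.coeFn_injective ?_⟩
  refine Continuous.ext_on hd U.continuous T'.continuous fun x hx => ?_
  rw [hU ⟨x, hx⟩, hT' ⟨x, hx⟩]
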